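/- Conventions. Let $(\mathbb X,d)$ be a complete, locally compact metric space in which any two points have a midpoint, and which is locally strongly convex: for each $x$, all sufficiently small open balls $B_r(x)$ are strongly convex, i.e. any two of their points are joined by a unique shortest path lying in the ball, and it depends continuously on the end points. Write $D_a(K)=\{y: d(y,K)\le a\}$, $D_\rho(x)$ for closed balls, and let $H=\bigoplus_\ell H_\ell$ be (relative) singular homology with integer coefficients. A topological ball is a space homeomorphic to a closed Euclidean ball of some dimension $n\ge 0$. A (tame) homology stratification of $K\subseteq\mathbb X$ is a locally finite family $\mathcal S$ of pairwise disjoint, locally closed sets with union $K$ such that $X\cap\overline Y\ne\emptyset$ implies $X\subseteq\overline Y$ for $X,Y\in\mathcal S$, and such that: (1) each $X\in\mathcal S$ is a finite dimensional homology manifold, i.e. there is $n$ such that for all $x\in X$, $H_n(X,X-\{x\})\cong\mathbb Z$ and $H_\ell(X,X-\{x\})=0$ for $\ell\ne n$; (2) for $x\in X\in\mathcal S$ there is $r_0>0$ such that for all $0<r<r_0$, all $y\in B_r(x)\cap X$, all $0<\rho<r-d(x,y)$ and all $\ell$, the inclusion induced maps $H_\ell(K,K-B_r(x))\to H_\ell(K,K-\{x\})$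 and $H_\ell(K,K-B_r(x))\to H_\ell(K,K-B_\rho(y))\to H_\ell(K,K-\{y\})$ are isomorphisms; moreover each $H_\ell(K,K-\{x\})$, $x\in K$, is finitely generated. For $x\in K$ put $F(a,b)=H(D_a(K),D_a(K)-B_b(x))$ if $a>0$ or $b>0$, and $F(0,0)=H(K,K-\{x\})$. For $\varepsilon\ge0$ let $A_x(\varepsilon)$ be the set of all triples $(R,r,\alpha)$ with $R\ge r>\alpha\ge\varepsilon$ such that (i) $D_\rho(x)$ is a topological ball for all $\rho\in(0,R]$; (ii) the inclusion induced maps $F(0,R)\to F(0,\rho)\to F(0,0)$ are isomorphisms for all $\rho\in(0,R]$; (iii) if $i_*:F(0,R)\to F(\varepsilon,R)$ and $j_*:F(\varepsilon,R)\to F(\alpha,r)$ are induced by inclusions, then $j_*\circ i_*:F(0,R)\to\operatorname{im} j_*$ is an isomorphism. For $L\subseteq K$ let $A_L(\varepsilon)=\bigcap_{x\in L}A_x(\varepsilon)$ and $A_L(\varepsilon\,|\,\alpha=\alpha')=\{(R,r):(R,r,\alpha')\in A_L(\varepsilon)\}$. The collection $A_L(\varepsilon)$, $\varepsilon\ge 0$,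 is weakly seemly if there are $\varepsilon_0>0$ and functions $\alpha^l<\alpha^u$ from $[0,\varepsilon_0]$ to $[0,\infty)$ such that: $\alpha^l$ is non-decreasing and $\alpha^u$ is non-increasing; $\alpha^l(\varepsilon)\to0=\alpha^l(0)$ and $\alpha^u(\varepsilon)\to\alpha^u(0)$ as $\varepsilon\to0$; $A_L(\varepsilon\,|\,\alpha=\alpha')\neq\emptyset$ for all $\varepsilon\in[0,\varepsilon_0]$ and $\alpha'\in[\alpha^l(\varepsilon),\alpha^u(\varepsilon)]$; and $$\sup_{\alpha'\in[\alpha^l(\varepsilon),\alpha^u(\varepsilon)]} d_H\big(A_L(0\,|\,\alpha=\alpha'),A_L(\varepsilon\,|\,\alpha=\alpha')\big)\to0\quad\text{as }\varepsilon\to0,$$ where $d_H$ is the ($[0,\infty]$-valued) Hausdorff distance in the plane. Theorem. Let $K\subseteq\mathbb X$ be compact with a homology stratification $\mathcal S$, let $K$ be a neighborhood retract (there are a neighborhood $U$ of $K$ and a continuous $\pi:U\to K$ with $\pi|_K=\mathrm{id}$), and suppose that sufficiently small closed balls centered on $K$ are topological balls: there is $\delta>0$ such that $D_\rho(x)$ is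 a topological ball for all $x\in K$ and $0<\rho\le\delta$. Then $K$ is weakly locally homologically seemly: for each stratum $X\in\mathcal S$ and all sufficiently small $w>0$, the collection $A_{X^w}(\varepsilon)$, $\varepsilon\ge0$, is weakly seemly, where $X^w=X-B_w(\partial X)$, $\partial X=\overline X-X$ and $B_w(\partial X)=\{y : d(y,\partial X)<w\}$ (empty if $\partial X=\emptyset$). -/

import Mathlib

namespace Seemly

universe u

noncomputable section

open CategoryTheory Filter Topology

/-! ### Relative singular homology with integer coefficients -/

/-- The integral singular chain complex of a topological space. -/
abbrev singularChains : TopCat.{u} ⥤ ChainComplex (ModuleCat.{u} ℤ) ℕ :=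
  (AlgebraicTopology.singularChainComplexFunctor (ModuleCat.{u} ℤ)).obj
    (ModuleCat.of ℤ (ULift.{u} ℤ))

/-- The relative singular chain complex `C(P) / C(Q)` of a topological pair `(P, Q)`. -/
def relChains (P : TopPair.{u}) : ChainComplex (ModuleCat.{u} ℤ) ℕ :=
  Limits.cokernel (singularChains.map P.map)

/-- The chain map between relative singular chain complexes induced by a map of pairs. -/
def relChainsMap {P Q : TopPair.{u}} (f : P ⟶ Q) : relChains P ⟶ relChains Q :=
  Limits.cokernel.map _ _ (singularChains.map (TopPair.Hom.snd f))
    (singularChains.map (TopPair.Hom.fst f))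
    (by rw [← Functor.map_comp, ← Functor.map_comp, TopPair.Hom.w])

variable {𝕏 : Type u} [TopologicalSpace 𝕏]

/-- The topological pair `(A, A - U)`, for subsets `A`, `U` of an ambient space. -/
def complPair (A U : Set 𝕏) : TopPair.{u} :=
  TopPair.ofSubset (X := TopCat.of A) {a : A | (a : 𝕏) ∉ U}

/-- The inclusion of pairs `(A, A - U) → (A', A' - U')`, for `A ⊆ A'` and `U' ⊆ U`. -/
def complPairIncl {A A' U U' : Set 𝕏} (hA : A ⊆ A') (hU : U' ⊆ U) :
    complPair A U ⟶ complPair A' U' :=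
  TopPair.ofHom
    (TopCat.ofHom ⟨fun a : A => (⟨a.1, hA a.2⟩ : A'), by fun_prop⟩)
    (TopCat.ofHom
      ⟨fun a : {a : A | (a : 𝕏) ∉ U} =>
        (⟨⟨a.1.1, hA a.1.2⟩, fun h => a.2 (hU h)⟩ : {a : A' | (a : 𝕏) ∉ U'}), by fun_prop⟩)
    (by rfl)

/-- The relative singular homology group `H_ℓ(A, A - U)`. -/
def H (l : ℕ) (A U : Set 𝕏) : ModuleCat.{u} ℤ := (relChains (complPair A U)).homology l

/-- The inclusion induced homomorphism `H_ℓ(A, A - U) → H_ℓ(A', A' - U')`,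
for `A ⊆ A'` and `U' ⊆ U`. -/
def HMap (l : ℕ) {A A' U U' : Set 𝕏} (hA : A ⊆ A') (hU : U' ⊆ U) :
    H l A U →ₗ[ℤ] H l A' U' :=
  (HomologicalComplex.homologyMap (relChainsMap (complPairIncl hA hU)) l).hom

/-! ### The ambient metric space -/

/-- Any two points of the metric space have a midpoint. -/
def HasMidpoints (𝕏 : Type u) [MetricSpace 𝕏] : Prop :=
  ∀ x y : 𝕏, ∃ z : 𝕏, dist x y = 2 * dist x z ∧ dist x y = 2 * dist y z

/-- `γ`, restricted to `[0,1]`, is a shortest path from `x` to `y`, i.e. a curve whose length is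
`dist x y`, parametrized proportionally to arc length. -/
def IsShortestPath {𝕏 : Type u} [MetricSpace 𝕏] (x y : 𝕏) (γ : ℝ → 𝕏) : Prop :=
  γ 0 = x ∧ γ 1 = y ∧
    ∀ s ∈ Set.Icc (0 : ℝ) 1, ∀ t ∈ Set.Icc (0 : ℝ) 1, dist (γ s) (γ t) = |s - t| * dist x y

/-- `A` is strongly convex: any two points of `A` are connected by a unique shortest path lying
in `A`, and this path depends continuously on the end points. -/
def IsStronglyConvex {𝕏 : Type u} [MetricSpace 𝕏] (A : Set 𝕏) : Prop :=
  ∃ γ : 𝕏 → 𝕏 → ℝ → 𝕏,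
    (∀ x ∈ A, ∀ y ∈ A,
      IsShortestPath x y (γ x y) ∧ (∀ t ∈ Set.Icc (0 : ℝ) 1, γ x y t ∈ A) ∧
      ∀ η : ℝ → 𝕏, IsShortestPath x y η → (∀ t ∈ Set.Icc (0 : ℝ) 1, η t ∈ A) →
        ∀ t ∈ Set.Icc (0 : ℝ) 1, η t = γ x y t) ∧
    ContinuousOn (fun p : 𝕏 × 𝕏 × ℝ => γ p.1 p.2.1 p.2.2) (A ×ˢ A ×ˢ Set.Icc (0 : ℝ) 1)

/-- All sufficiently small open balls at any point are strongly convex. -/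
def LocallyStronglyConvex (𝕏 : Type u) [MetricSpace 𝕏] : Prop :=
  ∀ x : 𝕏, ∃ δ > 0, ∀ r : ℝ, 0 < r → r < δ → IsStronglyConvex (Metric.ball x r)

/-- `B` is homeomorphic to the closed unit ball of a Euclidean space. -/
def IsTopologicalBall (B : Set 𝕏) : Prop :=
  ∃ n : ℕ, Nonempty (B ≃ₜ Metric.closedBall (0 : EuclideanSpace ℝ (Fin n)) 1)

/-! ### Stratifications -/

/-- There is a retraction onto `K` of some neighborhood of `K`. -/
def IsNeighborhoodRetract (K : Set 𝕏) : Prop :=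
  ∃ U ∈ 𝓝ˢ K, ∃ π : 𝕏 → 𝕏, ContinuousOn π U ∧ Set.MapsTo π U K ∧ ∀ x ∈ K, π x = x

/-- A stratification of `K`: a locally finite partition into locally closed sets which satisfies
the frontier condition. -/
structure IsStratification (K : Set 𝕏) (S : Set (Set 𝕏)) : Prop where
  locallyFinite : LocallyFinite (fun X : S => (X : Set 𝕏))
  pairwiseDisjoint : ∀ X ∈ S, ∀ Y ∈ S, X ≠ Y → Disjoint X Y
  isLocallyClosed : ∀ X ∈ S, IsLocallyClosed X
  sUnion_eq : ⋃₀ S = K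
  frontier : ∀ X ∈ S, ∀ Y ∈ S, (X ∩ closure Y).Nonempty → X ⊆ closure Y

/-- `X` is a (finite dimensional) homology manifold. -/
def IsHomologyManifold (X : Set 𝕏) : Prop :=
  ∃ n : ℕ, ∀ x ∈ X,
    Nonempty (H n X {x} ≃ₗ[ℤ] ℤ) ∧ ∀ l : ℕ, l ≠ n → Subsingleton (H l X {x})

/-- A (tame) homology stratification of `K`. -/
structure IsHomologyStratification {𝕏 : Type u} [MetricSpace 𝕏] (K : Set 𝕏) (S : Set (Set 𝕏)) :
    Prop extends IsStratification K S where
  isHomologyManifold : ∀ X ∈ S, IsHomologyManifold X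
  local_iso : ∀ X ∈ S, ∀ x ∈ X, ∃ r₀ > 0, ∀ r : ℝ, ∀ hr : 0 < r, r < r₀ → ∀ l : ℕ,
    Function.Bijective (HMap l (subset_refl K)
      (Set.singleton_subset_iff.2 (Metric.mem_ball_self hr) : {x} ⊆ Metric.ball x r)) ∧
    ∀ y ∈ Metric.ball x r ∩ X, ∀ ρ : ℝ, ∀ hρ : 0 < ρ, ∀ h : ρ < r - dist x y,
      Function.Bijective (HMap l (subset_refl K)
        (Metric.ball_subset_ball' (by rw [dist_comm]; linarith) :
          Metric.ball y ρ ⊆ Metric.ball x r)) ∧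
      Function.Bijective (HMap l (subset_refl K)
        (Set.singleton_subset_iff.2 (Metric.mem_ball_self hρ) : {y} ⊆ Metric.ball y ρ))
  finite : ∀ x ∈ K, ∀ l : ℕ, Module.Finite ℤ (H l K {x})

/-! ### Admissible scales and weak seemliness -/

section

variable {𝕏 : Type u} [MetricSpace 𝕏]

/-- The set `A(ε)` of triples `(R, r, α)` with `R ≥ r > α ≥ ε`. -/
def scaleTriples (ε : ℝ) : Set (ℝ × ℝ × ℝ) :=
  {p | p.2.1 ≤ p.1 ∧ p.2.2 < p.2.1 ∧ ε ≤ p.2.2}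

/-- The set `A_x(ε)` of admissible triples `(R, r, α)` at a point `x` (`0 ≤ ε`).
Here `D_a(K) = Metric.cthickening a K`, and for `F(a, b) = H(D_a(K), D_a(K) - B_b(x))` the maps
`i : F(0, R) → F(ε, R)`, `j : F(ε, R) → F(α, r)` are induced by inclusions. Homology of all
degrees is considered, so that conditions on direct sums of maps are stated degreewise. -/
def admissible (K : Set 𝕏) (x : 𝕏) (ε : ℝ) : Set (ℝ × ℝ × ℝ) :=
  {p | p ∈ scaleTriples ε ∧
    (∀ ρ : ℝ, 0 < ρ → ρ ≤ p.1 → IsTopologicalBall (Metric.closedBall x ρ)) ∧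
    (∀ l : ℕ, ∀ ρ : ℝ, ∀ hρ : 0 < ρ, ∀ h : ρ ≤ p.1,
      Function.Bijective (HMap l (subset_refl K)
        (Metric.ball_subset_ball h : Metric.ball x ρ ⊆ Metric.ball x p.1)) ∧
      Function.Bijective (HMap l (subset_refl K)
        (Set.singleton_subset_iff.2 (Metric.mem_ball_self hρ) : {x} ⊆ Metric.ball x ρ))) ∧
    ∃ (hα : ε ≤ p.2.2) (hr : p.2.1 ≤ p.1), ∀ l : ℕ,
      let i := HMap l (Metric.self_subset_cthickening (δ := ε) K)
        (subset_refl (Metric.ball x p.1))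
      let j := HMap l (Metric.cthickening_mono hα K) (Metric.ball_subset_ball (x := x) hr)
      Function.Bijective (j.rangeRestrict ∘ₗ i)}

/-- `A_L(ε)`, the intersection of the sets `A_x(ε)` over `x ∈ L`. -/
def admissibleOn (K L : Set 𝕏) (ε : ℝ) : Set (ℝ × ℝ × ℝ) :=
  ⋂ x ∈ L, admissible K x ε

/-- The `α`-section at `a` of a set of triples `(R, r, α)`. -/
def alphaSection (A : Set (ℝ × ℝ × ℝ)) (a : ℝ) : Set (ℝ × ℝ) :=
  {q | (q.1, q.2, a) ∈ A}

/-- Weak seemliness of a collection of sets `A(ε)`, `ε ≥ 0`, of triples `(R, r, α)`. The Hausdorff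
distance between planar sections takes values in `[0, ∞]`; the choice of the norm on the plane is
irrelevant for its convergence to zero. -/
def IsWeaklySeemly (A : ℝ → Set (ℝ × ℝ × ℝ)) : Prop :=
  ∃ ε₀ > 0, ∃ αl αu : ℝ → ℝ,
    (∀ ε ∈ Set.Icc 0 ε₀, 0 ≤ αl ε ∧ αl ε < αu ε) ∧
    MonotoneOn αl (Set.Icc 0 ε₀) ∧ AntitoneOn αu (Set.Icc 0 ε₀) ∧
    αl 0 = 0 ∧ Tendsto αl (𝓝[>] 0) (𝓝 0) ∧ Tendsto αu (𝓝[>] 0) (𝓝 (αu 0)) ∧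
    (∀ ε ∈ Set.Icc 0 ε₀, ∀ a ∈ Set.Icc (αl ε) (αu ε), (alphaSection (A ε) a).Nonempty) ∧
    Tendsto (fun ε => ⨆ a ∈ Set.Icc (αl ε) (αu ε),
      Metric.hausdorffEDist (alphaSection (A 0) a) (alphaSection (A ε) a)) (𝓝[>] 0) (𝓝 0)

/-- `X^w`, the stratum `X` with the open `w`-neighborhood of `∂X = closure X - X` removed. -/
def shrink (X : Set 𝕏) (w : ℝ) : Set 𝕏 :=
  X \ Metric.thickening w (closure X \ X)

/-- `K` is weakly locally homologically seemly with respect to the stratification `S`. -/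
def IsWeaklyLocallyHomologicallySeemly (K : Set 𝕏) (S : Set (Set 𝕏)) : Prop :=
  ∀ X ∈ S, ∀ᶠ w in 𝓝[>] (0 : ℝ), IsWeaklySeemly (admissibleOn K (shrink X w))

end

end

end Seemly

open CategoryTheory Filter Topology

namespace Seemly

universe u

noncomputable section

/-! ### Functoriality and homotopy invariance of relative singular homology -/

/-! A neighborhood retraction `π` moves the points of `D_ε(K)` by at most some `m(ε)` with `m(ε) →
0`. The theorem holds with `α^l = m` and `α^u` a small constant.

Admissibility of `(R, r, α)` for `ε` splits into three parts: `R` is a good radius; the composite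
`F(0,R) → F(α,r)`, which does not depend on `ε`, is injective; and its image is all of `im j`
(`mem_admissible`). For the last part, slide `D_ε(K)` to `K` along the short geodesics from `y` to
`π y`. They stay in `D_α(K)` if `m(ε) ≤ α`, and paths starting outside `B_R(x)` avoid `B_r(x)` if `r
+ m(ε) ≤ R` (`range_HMap_le_of_homotopy`).

Hence a triple admissible for `0` stays admissible for `ε` unless `R - r < m(ε)`. In that case
either `R` is raised or `r` is lowered, by at most `m(ε)`. Raising a small `R` keeps injectivity
because `F(0,R)` does not change (`TubeInjective.mono_radius`); lowering an `r` close to a large `R`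
keeps it because `π` provides a left inverse up to isomorphism (`tubeInjective_of_retraction`). As
`A(ε) ⊆ A(0)`, this bounds the Hausdorff distance by `m(ε)`. -/

/-- The projection `C(P) → C(P) / C(Q)`. -/
def relChainsπ (P : TopPair.{u}) : singularChains.obj P.fst ⟶ relChains P :=
  Limits.cokernel.π (singularChains.map P.map)

instance epi_relChainsπ (P : TopPair.{u}) : Epi (relChainsπ P) :=
  inferInstanceAs (Epi (Limits.cokernel.π (singularChains.map P.map)))

lemma relChainsπ_relChainsMap {P Q : TopPair.{u}} (f : P ⟶ Q) :
    relChainsπ P ≫ relChainsMap f = singularChains.map (TopPair.Hom.fst f) ≫ relChainsπ Q :=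
  Limits.cokernel.π_desc _ _ _

lemma relChainsMap_comp {P Q R : TopPair.{u}} (f : P ⟶ Q) (g : Q ⟶ R) :
    relChainsMap (f ≫ g) = relChainsMap f ≫ relChainsMap g := by
  rw [← cancel_epi (relChainsπ P), relChainsπ_relChainsMap, ← Category.assoc,
    relChainsπ_relChainsMap, Category.assoc, relChainsπ_relChainsMap,
    show TopPair.Hom.fst (f ≫ g) = TopPair.Hom.fst f ≫ TopPair.Hom.fst g from rfl,
    Functor.map_comp, Category.assoc]

/-- The map induced on relative singular homology by a map of pairs. -/
def relHomologyMap (l : ℕ) {P Q : TopPair.{u}} (f : P ⟶ Q) :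
    (relChains P).homology l ⟶ (relChains Q).homology l :=
  HomologicalComplex.homologyMap (relChainsMap f) l

lemma relHomologyMap_comp (l : ℕ) {P Q R : TopPair.{u}} (f : P ⟶ Q) (g : Q ⟶ R) :
    relHomologyMap l (f ≫ g) = relHomologyMap l f ≫ relHomologyMap l g := by
  rw [relHomologyMap, relChainsMap_comp, HomologicalComplex.homologyMap_comp]
  rfl

instance mono_singularChains_map (P : TopPair.{u}) : Mono (singularChains.map P.map) := by
  have : Mono P.map := (TopCat.mono_iff_injective _).2 P.isEmbedding_map.injective
  infer_instance

/-- The short complex `C(Q) → C(P) → C(P, Q)` of a pair `(P, Q)`. -/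
def relChainsShortComplex (P : TopPair.{u}) :
    ShortComplex (ChainComplex (ModuleCat.{u} ℤ) ℕ) :=
  ShortComplex.mk (singularChains.map P.map) (Limits.cokernel.π (singularChains.map P.map))
    (Limits.cokernel.condition _)

lemma relChainsShortComplex_shortExact (P : TopPair.{u}) :
    (relChainsShortComplex P).ShortExact where
  exact := ShortComplex.exact_cokernel _
  mono_f := mono_singularChains_map P
  epi_g := by dsimp [relChainsShortComplex]; infer_instance

/-- The map of short complexes induced by a map of pairs. -/
def relChainsShortComplexMap {P Q : TopPair.{u}} (f : P ⟶ Q) :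
    relChainsShortComplex P ⟶ relChainsShortComplex Q where
  τ₁ := singularChains.map (TopPair.Hom.snd f)
  τ₂ := singularChains.map (TopPair.Hom.fst f)
  τ₃ := relChainsMap f
  comm₁₂ := by
    dsimp [relChainsShortComplex]
    rw [← Functor.map_comp, ← Functor.map_comp, TopPair.Hom.w]
  comm₂₃ := by
    dsimp [relChainsShortComplex, relChainsMap]
    simp

/-- Five lemma for the long exact homology sequences of the two pairs. -/
lemma isIso_relHomologyMap (l : ℕ) {P Q : TopPair.{u}} (f : P ⟶ Q)
    (h₁ : QuasiIso (singularChains.map (TopPair.Hom.snd f)))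
    (h₂ : QuasiIso (singularChains.map (TopPair.Hom.fst f))) :
    IsIso (relHomologyMap l f) := by
  have := HomologicalComplex.HomologySequence.quasiIso_τ₃ (relChainsShortComplexMap f)
    (relChainsShortComplex_shortExact P) (relChainsShortComplex_shortExact Q) h₁ h₂
  have h : QuasiIso (relChainsMap f) := this
  rw [quasiIso_iff] at h
  exact (quasiIsoAt_iff_isIso_homologyMap _ _).1 (h l)

/-- The projection of the cylinder on `X`. -/
def cylProj (X : TopCat.{u}) : TopCat.of (unitInterval × X) ⟶ X :=
  TopCat.ofHom ⟨Prod.snd, by fun_prop⟩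

/-- The inclusion of `X` into the cylinder at height `t`. -/
def cylIncl (t : unitInterval) (X : TopCat.{u}) : X ⟶ TopCat.of (unitInterval × X) :=
  TopCat.ofHom ⟨fun x => (t, x), by fun_prop⟩

/-- The cylinder retracts by deformation onto its bottom. -/
def cylContraction (X : TopCat.{u}) :
    TopCat.Homotopy (cylProj X ≫ cylIncl 0 X) (𝟙 (TopCat.of (unitInterval × X))) where
  toFun p := (p.1 * p.2.1, p.2.2)
  continuous_toFun := by fun_prop
  map_zero_left p := by ext <;> simp [cylProj, cylIncl]
  map_one_left p := by ext <;> simp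

lemma quasiIso_cylProj (X : TopCat.{u}) : QuasiIso (singularChains.map (cylProj X)) := by
  rw [quasiIso_iff]
  intro l
  rw [quasiIsoAt_iff_isIso_homologyMap]
  refine ⟨HomologicalComplex.homologyMap (singularChains.map (cylIncl 0 X)) l, ?_, ?_⟩
  · rw [← HomologicalComplex.homologyMap_comp, ← Functor.map_comp,
      (cylContraction X).congr_homologyMap_singularChainComplexFunctor, CategoryTheory.Functor.map_id,
      HomologicalComplex.homologyMap_id]
  · rw [← HomologicalComplex.homologyMap_comp, ← Functor.map_comp,
      show cylIncl 0 X ≫ cylProj X = 𝟙 X from rfl, CategoryTheory.Functor.map_id,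
      HomologicalComplex.homologyMap_id]

/-- The cylinder `(I × P, I × Q)` on a pair `(P, Q)`. -/
def cylPair (P : TopPair.{u}) : TopPair.{u} :=
  TopPair.of (A := TopCat.of (unitInterval × P.snd)) (X := TopCat.of (unitInterval × P.fst))
    (TopCat.ofHom ⟨Prod.map id P.map, by fun_prop⟩)
    (Topology.IsEmbedding.id.prodMap P.isEmbedding_map)

/-- The projection of the cylinder on a pair. -/
def cylPairProj (P : TopPair.{u}) : cylPair P ⟶ P :=
  TopPair.ofHom (X := cylPair P) (cylProj P.fst) (cylProj P.snd) rfl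

/-- The inclusion of a pair into its cylinder at height `t`. -/
def cylPairIncl (t : unitInterval) (P : TopPair.{u}) : P ⟶ cylPair P :=
  TopPair.ofHom (Y := cylPair P) (cylIncl t P.fst) (cylIncl t P.snd) rfl

/-- All these inclusions are sections of the cylinder projection, which is an isomorphism in
relative homology. -/
lemma relHomologyMap_cylPairIncl (l : ℕ) (s t : unitInterval) (P : TopPair.{u}) :
    relHomologyMap l (cylPairIncl s P) = relHomologyMap l (cylPairIncl t P) := by
  have := isIso_relHomologyMap l (cylPairProj P) (quasiIso_cylProj _) (quasiIso_cylProj _)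
  rw [← cancel_mono (relHomologyMap l (cylPairProj P)), ← relHomologyMap_comp,
    ← relHomologyMap_comp]
  rfl

/-- Homotopic maps of pairs induce the same map on relative singular homology. -/
lemma relHomologyMap_eq_of_cylPair (l : ℕ) {P Q : TopPair.{u}} (F : cylPair P ⟶ Q) :
    relHomologyMap l (cylPairIncl 0 P ≫ F) = relHomologyMap l (cylPairIncl 1 P ≫ F) := by
  rw [relHomologyMap_comp, relHomologyMap_comp, relHomologyMap_cylPairIncl l 0 1]

/-! ### Maps of pairs of subsets -/

section

variable {𝕏 : Type u} [TopologicalSpace 𝕏]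

/-- `f` restricts to a map of pairs `(A, A - U) → (B, B - V)`. -/
structure IsComplPairMap (f : 𝕏 → 𝕏) (A U B V : Set 𝕏) : Prop where
  continuousOn : ContinuousOn f A
  mapsTo : Set.MapsTo f A B
  notMem : ∀ a ∈ A, a ∉ U → f a ∉ V

variable {f g : 𝕏 → 𝕏} {A U B V C W : Set 𝕏}

/-- The map of pairs `(A, A - U) → (B, B - V)` given by restriction of `f`. -/
def IsComplPairMap.toHom (hf : IsComplPairMap f A U B V) : complPair A U ⟶ complPair B V :=
  TopPair.ofHom
    (TopCat.ofHom ⟨fun a : A => (⟨f a.1, hf.mapsTo a.2⟩ : B),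
      (continuousOn_iff_continuous_domRestrict.1 hf.continuousOn).subtype_mk _⟩)
    (TopCat.ofHom
      ⟨fun a : {a : A | (a : 𝕏) ∉ U} =>
        (⟨⟨f a.1.1, hf.mapsTo a.1.2⟩, hf.notMem _ a.1.2 a.2⟩ : {b : B | (b : 𝕏) ∉ V}),
        (((continuousOn_iff_continuous_domRestrict.1 hf.continuousOn).comp
          continuous_subtype_val).subtype_mk _).subtype_mk _⟩)
    (by rfl)

/-- The map `H_ℓ(A, A - U) → H_ℓ(B, B - V)` induced by `f`. -/
def IsComplPairMap.hMap (hf : IsComplPairMap f A U B V) (l : ℕ) : H l A U →ₗ[ℤ] H l B V :=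
  (relHomologyMap l hf.toHom).hom

lemma isComplPairMap_id (hA : A ⊆ B) (hU : V ⊆ U) : IsComplPairMap id A U B V :=
  ⟨continuousOn_id, hA, fun _ _ h h' => h (hU h')⟩

lemma isComplPairMap_id_hMap (hA : A ⊆ B) (hU : V ⊆ U) (l : ℕ) :
    (isComplPairMap_id hA hU).hMap l = HMap l hA hU := rfl

lemma IsComplPairMap.comp (hg : IsComplPairMap g B V C W) (hf : IsComplPairMap f A U B V) :
    IsComplPairMap (g ∘ f) A U C W :=
  ⟨hg.continuousOn.comp hf.continuousOn hf.mapsTo, hg.mapsTo.comp hf.mapsTo,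
    fun a ha hU => hg.notMem _ (hf.mapsTo ha) (hf.notMem a ha hU)⟩

lemma IsComplPairMap.comp_hMap (hg : IsComplPairMap g B V C W) (hf : IsComplPairMap f A U B V)
    (l : ℕ) : (hg.comp hf).hMap l = hg.hMap l ∘ₗ hf.hMap l := by
  have : (hg.comp hf).toHom = hf.toHom ≫ hg.toHom := rfl
  rw [hMap, this, relHomologyMap_comp]
  rfl

lemma IsComplPairMap.hMap_congr (hf : IsComplPairMap f A U B V) (hg : IsComplPairMap g A U B V)
    (h : Set.EqOn f g A) (l : ℕ) : hf.hMap l = hg.hMap l := by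
  have : hf.toHom = hg.toHom := by
    refine MorphismProperty.Arrow.Hom.ext ?_ ?_
    · ext a
      exact Subtype.ext (Subtype.ext (h a.1.2))
    · ext a
      exact Subtype.ext (h a.2)
  rw [hMap, this, hMap]

lemma HMap_comp (hA : A ⊆ B) (hU : V ⊆ U) (hB : B ⊆ C) (hV : W ⊆ V) (l : ℕ) :
    HMap l (hA.trans hB) (hV.trans hU) = HMap l hB hV ∘ₗ HMap l hA hU :=
  (isComplPairMap_id hB hV).comp_hMap (isComplPairMap_id hA hU) l

/-- Homotopic maps of pairs of subsets induce the same map in homology. -/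
lemma IsComplPairMap.hMap_eq_of_homotopy (hf : IsComplPairMap f A U B V)
    (hg : IsComplPairMap g A U B V) (h : 𝕏 → ℝ → 𝕏)
    (hc : ContinuousOn (fun p : 𝕏 × ℝ => h p.1 p.2) (A ×ˢ Set.Icc (0 : ℝ) 1))
    (hm : ∀ a ∈ A, ∀ t ∈ Set.Icc (0 : ℝ) 1, h a t ∈ B)
    (hn : ∀ a ∈ A, a ∉ U → ∀ t ∈ Set.Icc (0 : ℝ) 1, h a t ∉ V)
    (h₀ : ∀ a ∈ A, h a 0 = f a) (h₁ : ∀ a ∈ A, h a 1 = g a) (l : ℕ) :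
    hf.hMap l = hg.hMap l := by
  have hc' : Continuous fun p : unitInterval × A => h p.2.1 p.1.1 :=
    hc.comp_continuous (f := fun p : unitInterval × A => (p.2.1, p.1.1)) (by fun_prop)
      fun p => ⟨p.2.2, p.1.2⟩
  let F : cylPair (complPair A U) ⟶ complPair B V :=
    TopPair.ofHom (X := cylPair (complPair A U)) (Y := complPair B V)
      (TopCat.ofHom ⟨fun p : unitInterval × A => (⟨h p.2.1 p.1.1, hm _ p.2.2 _ p.1.2⟩ : B),
        hc'.subtype_mk _⟩)
      (TopCat.ofHom ⟨fun p : unitInterval × {a : A | (a : 𝕏) ∉ U} =>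
        (⟨⟨h p.2.1.1 p.1.1, hm _ p.2.1.2 _ p.1.2⟩, hn _ p.2.1.2 p.2.2 _ p.1.2⟩ :
          {b : B | (b : 𝕏) ∉ V}),
        ((hc'.comp (f := fun p : unitInterval × {a : A | (a : 𝕏) ∉ U} => (p.1, p.2.1))
          (by fun_prop)).subtype_mk _).subtype_mk _⟩)
      (by rfl)
  have e₀ : hf.toHom = cylPairIncl 0 _ ≫ F := by
    refine MorphismProperty.Arrow.Hom.ext ?_ ?_
    · ext a
      exact Subtype.ext (Subtype.ext (h₀ _ a.1.2).symm)
    · ext a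
      exact Subtype.ext (h₀ _ a.2).symm
  have e₁ : hg.toHom = cylPairIncl 1 _ ≫ F := by
    refine MorphismProperty.Arrow.Hom.ext ?_ ?_
    · ext a
      exact Subtype.ext (Subtype.ext (h₁ _ a.1.2).symm)
    · ext a
      exact Subtype.ext (h₁ _ a.2).symm
  rw [hMap, hMap, e₀, e₁, relHomologyMap_eq_of_cylPair]

/-- If `f` maps `(B, B - V)` to `(C, C - W)` and is the identity on `A`, then
`H_ℓ(A, A - U) → H_ℓ(B, B - V)` is injective as soon as `H_ℓ(A, A - U) → H_ℓ(C, C - W)` is. -/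
lemma HMap_injective_of_retract (hf : IsComplPairMap f B V C W) (hid : ∀ a ∈ A, f a = a)
    (hAB : A ⊆ B) (hVU : V ⊆ U) (hAC : A ⊆ C) (hWU : W ⊆ U) (l : ℕ)
    (hi : Function.Injective (HMap l hAC hWU)) : Function.Injective (HMap l hAB hVU) := by
  have h : hf.hMap l ∘ₗ HMap l hAB hVU = HMap l hAC hWU := by
    rw [← isComplPairMap_id_hMap hAB hVU, ← IsComplPairMap.comp_hMap,
      ← isComplPairMap_id_hMap hAC hWU]
    exact IsComplPairMap.hMap_congr _ _ (fun a ha => hid a ha) l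
  rw [← h, LinearMap.coe_comp] at hi
  exact hi.of_comp

end

/-! ### Short geodesics and small retractions -/

section

variable {𝕏 : Type u} [MetricSpace 𝕏]

/-- Near a compact set, nearby points are joined by a shortest path depending continuously on
the end points. -/
lemma exists_continuous_shortestPaths (hconv : LocallyStronglyConvex 𝕏) {K : Set 𝕏}
    (hK : IsCompact K) :
    ∃ δ > 0, ∃ γ : 𝕏 → 𝕏 → ℝ → 𝕏,
      (∀ y ∈ Metric.thickening δ K, ∀ z, dist y z < δ → IsShortestPath y z (γ y z)) ∧
      ContinuousOn (fun p : 𝕏 × 𝕏 × ℝ => γ p.1 p.2.1 p.2.2)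
        {p | p.1 ∈ Metric.thickening δ K ∧ dist p.1 p.2.1 < δ ∧ p.2.2 ∈ Set.Icc (0 : ℝ) 1} := by
  classical
  have h1 : ∀ x : 𝕏, ∃ r > 0, IsStronglyConvex (Metric.ball x r) := fun x => by
    obtain ⟨δ, hδ, h⟩ := hconv x
    exact ⟨δ / 2, by positivity, h _ (by positivity) (by linarith)⟩
  choose r hr γ hγ hγc using h1
  obtain ⟨δ, hδ, hleb⟩ := lebesgue_number_lemma_of_metric hK
    (c := fun x => Metric.ball x (r x / 3)) (fun _ => Metric.isOpen_ball)
    (fun x _ => Set.mem_iUnion.2 ⟨x, Metric.mem_ball_self (by have := hr x; positivity)⟩)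
  have hloc : ∀ y ∈ Metric.thickening (δ / 2) K, ∀ z, dist y z < δ / 2 →
      ∃ i, y ∈ Metric.ball i (r i / 3) ∧ z ∈ Metric.ball i (r i / 3) := by
    intro y hy z hz
    obtain ⟨x, hx, hyx⟩ := Metric.mem_thickening_iff.1 hy
    obtain ⟨i, hi⟩ := hleb x hx
    refine ⟨i, hi (Metric.mem_ball.2 (by linarith)), hi (Metric.mem_ball.2 ?_)⟩
    have := dist_triangle z y x
    rw [dist_comm z y] at this
    linarith
  have hsub : ∀ i, Metric.ball i (r i / 3) ⊆ Metric.ball i (r i) := fun i =>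
    Metric.ball_subset_ball (by have := hr i; linarith)
  -- A shortest path between two points of the ball of radius `r i / 3` has length below `2 * r i /
  -- 3`, so it cannot leave the ball of radius `r i`. Uniqueness thus holds among all shortest
  -- paths.
  have huniq : ∀ i, ∀ y ∈ Metric.ball i (r i / 3), ∀ z ∈ Metric.ball i (r i / 3),
      ∀ η, IsShortestPath y z η → ∀ t ∈ Set.Icc (0 : ℝ) 1, η t = γ i y z t := by
    intro i y hy z hz η hη t ht
    refine (hγ i y (hsub i hy) z (hsub i hz)).2.2 η hη (fun s hs => ?_) t ht
    have h0 := hη.2.2 s hs 0 (by simp)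
    rw [hη.1, sub_zero, abs_of_nonneg hs.1] at h0
    have h2 : s * dist y z ≤ dist y z := mul_le_of_le_one_left dist_nonneg hs.2
    have h3 := dist_triangle (η s) y i
    have h4 := dist_triangle_right y z i
    rw [Metric.mem_ball] at hy hz ⊢
    linarith
  -- By uniqueness this choice agrees on `[0,1]` with every local `γ i`, and so inherits their
  -- continuity.
  let Γ : 𝕏 → 𝕏 → ℝ → 𝕏 := fun y z =>
    if h : ∃ η, IsShortestPath y z η then h.choose else fun _ => y
  have hΓ : ∀ i, ∀ y ∈ Metric.ball i (r i / 3), ∀ z ∈ Metric.ball i (r i / 3),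
      IsShortestPath y z (Γ y z) := by
    intro i y hy z hz
    have h : ∃ η, IsShortestPath y z η := ⟨_, (hγ i y (hsub i hy) z (hsub i hz)).1⟩
    simp only [Γ, dif_pos h]
    exact h.choose_spec
  refine ⟨δ / 2, by positivity, Γ, fun y hy z hz => ?_, ?_⟩
  · obtain ⟨i, hi, hi'⟩ := hloc y hy z hz
    exact hΓ i y hi z hi'
  · rintro ⟨y, z, t⟩ ⟨hy, hz, ht⟩
    obtain ⟨i, hi, hi'⟩ := hloc y hy z hz
    have hnhds : {p : 𝕏 × 𝕏 × ℝ | p.1 ∈ Metric.ball i (r i / 3) ∧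
        p.2.1 ∈ Metric.ball i (r i / 3)} ∈ 𝓝 (y, z, t) :=
      ((Metric.isOpen_ball.preimage continuous_fst).inter
        (Metric.isOpen_ball.preimage (continuous_fst.comp continuous_snd))).mem_nhds ⟨hi, hi'⟩
    rw [← continuousWithinAt_inter hnhds]
    have hc : ContinuousWithinAt (fun p : 𝕏 × 𝕏 × ℝ => γ i p.1 p.2.1 p.2.2) _ (y, z, t) :=
      hγc i (y, z, t) ⟨hsub i hi, hsub i hi', ht⟩
    refine (hc.mono ?_).congr ?_ ?_
    · rintro p ⟨⟨_, _, hp⟩, hp₁, hp₂⟩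
      exact ⟨hsub i hp₁, hsub i hp₂, hp⟩
    · rintro p ⟨⟨_, _, hp⟩, hp₁, hp₂⟩
      exact huniq i _ hp₁ _ hp₂ _ (hΓ i _ hp₁ _ hp₂) _ hp
    · exact huniq i _ hi _ hi' _ (hΓ i _ hi _ hi') _ ht

/-- A retraction of a neighborhood of a compact set moves the points of small tubes little. -/
lemma exists_retraction {K : Set 𝕏} (hK : IsCompact K) (hret : IsNeighborhoodRetract K) :
    ∃ π : 𝕏 → 𝕏, (∀ x ∈ K, π x = x) ∧
      ∀ η > 0, ∃ ε > 0, ContinuousOn π (Metric.cthickening ε K) ∧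
        Set.MapsTo π (Metric.cthickening ε K) K ∧
        ∀ y ∈ Metric.cthickening ε K, dist y (π y) ≤ η := by
  obtain ⟨U, hU, π, hc, hm, hid⟩ := hret
  refine ⟨π, hid, fun η hη => ?_⟩
  have hN : {y | y ∈ U ∧ dist y (π y) ≤ η} ∈ 𝓝ˢ K := by
    rw [mem_nhdsSet_iff_forall]
    intro x hx
    have hUx : U ∈ 𝓝 x := mem_nhdsSet_iff_forall.1 hU x hx
    have hcx : ContinuousAt (fun y => dist y (π y)) x :=
      continuousAt_id.dist (hc.continuousAt hUx)
    have : ∀ᶠ y in 𝓝 x, dist y (π y) < η :=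
      hcx.eventually_lt continuousAt_const (by simpa [hid x hx] using hη)
    filter_upwards [hUx, this] with y h₁ h₂ using ⟨h₁, h₂.le⟩
  obtain ⟨V, hV, hKV, hVN⟩ := mem_nhdsSet_iff_exists.1 hN
  obtain ⟨ε, hε, hεV⟩ := hK.exists_cthickening_subset_open hV hKV
  have hsub := hεV.trans hVN
  exact ⟨ε, hε, hc.mono fun y hy => (hsub hy).1, fun y hy => hm (hsub hy).1,
    fun y hy => (hsub hy).2⟩

/-- The largest displacement of a point of the `ε`-tube around `K` by `π`. -/
def displacement (K : Set 𝕏) (π : 𝕏 → 𝕏) (ε : ℝ) : ℝ :=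
  sSup ((fun y => dist y (π y)) '' Metric.cthickening ε K)

variable {K : Set 𝕏} {π : 𝕏 → 𝕏} {ε₁ c ε ε' : ℝ}

/-- The bound `c` is needed because the real `sSup` of an unbounded set is `0`. -/
lemma dist_le_displacement (hc : ∀ y ∈ Metric.cthickening ε₁ K, dist y (π y) ≤ c) (hε : ε ≤ ε₁)
    {y : 𝕏} (hy : y ∈ Metric.cthickening ε K) : dist y (π y) ≤ displacement K π ε :=
  le_csSup ⟨c, by
    rintro _ ⟨z, hz, rfl⟩
    exact hc z (Metric.cthickening_mono hε K hz)⟩ (Set.mem_image_of_mem _ hy)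

lemma displacement_nonneg : 0 ≤ displacement K π ε :=
  Real.sSup_nonneg (by rintro _ ⟨z, -, rfl⟩; exact dist_nonneg)

lemma displacement_le (hc₀ : 0 ≤ c) (hc : ∀ y ∈ Metric.cthickening ε K, dist y (π y) ≤ c) :
    displacement K π ε ≤ c :=
  Real.sSup_le (by rintro _ ⟨z, hz, rfl⟩; exact hc z hz) hc₀

lemma displacement_mono (hc : ∀ y ∈ Metric.cthickening ε₁ K, dist y (π y) ≤ c) (hε : ε ≤ ε')
    (hε' : ε' ≤ ε₁) : displacement K π ε ≤ displacement K π ε' :=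
  displacement_le displacement_nonneg fun _ hy =>
    dist_le_displacement hc hε' (Metric.cthickening_mono hε K hy)

lemma displacement_zero (hK : IsClosed K) (hid : ∀ x ∈ K, π x = x) : displacement K π 0 = 0 :=
  le_antisymm (displacement_le le_rfl fun y hy => by
    rw [Metric.cthickening_zero, hK.closure_eq] at hy
    simp [hid y hy]) displacement_nonneg

/-- The shrunken stratum is compact. -/
lemma isCompact_shrink (hK : IsCompact K) {X : Set 𝕏} (hX : X ⊆ K) {w : ℝ} (hw : 0 < w) :
    IsCompact (shrink X w) := by
  have h : shrink X w = closure X ∩ (Metric.thickening w (closure X \ X))ᶜ := by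
    refine Set.Subset.antisymm (fun x hx => ⟨subset_closure hx.1, hx.2⟩) fun x hx => ⟨?_, hx.2⟩
    by_contra hxX
    exact hx.2 (Metric.self_subset_thickening hw _ ⟨hx.1, hxX⟩)
  rw [h]
  exact hK.of_isClosed_subset (isClosed_closure.inter Metric.isOpen_thickening.isClosed_compl)
    (Set.inter_subset_left.trans (closure_minimal hX hK.isClosed))

end

/-! ### Admissible triples -/

section

variable {𝕏 : Type u} [MetricSpace 𝕏]

/-- The conditions on the radius `R` in the definition of admissible triples at `x`. -/
def IsGoodRadius (K : Set 𝕏) (x : 𝕏) (R : ℝ) : Prop :=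
  (∀ ρ : ℝ, 0 < ρ → ρ ≤ R → IsTopologicalBall (Metric.closedBall x ρ)) ∧
  ∀ l : ℕ, ∀ ρ : ℝ, ∀ hρ : 0 < ρ, ∀ h : ρ ≤ R,
    Function.Bijective (HMap l (subset_refl K)
      (Metric.ball_subset_ball h : Metric.ball x ρ ⊆ Metric.ball x R)) ∧
    Function.Bijective (HMap l (subset_refl K)
      (Set.singleton_subset_iff.2 (Metric.mem_ball_self hρ) : {x} ⊆ Metric.ball x ρ))

/-- The map `H(K, K - B_R(x)) → H(D_α(K), D_α(K) - B_r(x))` is injective in all degrees. -/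
def TubeInjective (K : Set 𝕏) (x : 𝕏) (R r α : ℝ) (hr : r ≤ R) : Prop :=
  ∀ l : ℕ, Function.Injective (HMap l (Metric.self_subset_cthickening (δ := α) K)
    (Metric.ball_subset_ball (x := x) hr))

variable {K : Set 𝕏} {x : 𝕏} {R R' R₀ r ε α η : ℝ}

/-- Two out of three for `F(0,R) → F(0,ρ) → F(0,0)`: isomorphisms onto the local homology at `x`
suffice. -/
lemma isGoodRadius_of_le
    (hball : ∀ ρ : ℝ, 0 < ρ → ρ ≤ R₀ → IsTopologicalBall (Metric.closedBall x ρ))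
    (hpt : ∀ l : ℕ, ∀ ρ : ℝ, ∀ hρ : 0 < ρ, ρ ≤ R₀ → Function.Bijective (HMap l (subset_refl K)
      (Set.singleton_subset_iff.2 (Metric.mem_ball_self hρ) : {x} ⊆ Metric.ball x ρ)))
    (hR : R ≤ R₀) : IsGoodRadius K x R := by
  refine ⟨fun ρ hρ h => hball ρ hρ (h.trans hR), fun l ρ hρ h => ?_⟩
  have h₁ := hpt l ρ hρ (h.trans hR)
  have h₂ := hpt l R (hρ.trans_le h) hR
  refine ⟨?_, h₁⟩
  rw [HMap_comp (subset_refl K) (Metric.ball_subset_ball h) (subset_refl K)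
    (Set.singleton_subset_iff.2 (Metric.mem_ball_self hρ)), LinearMap.coe_comp] at h₂
  exact (Function.Bijective.of_comp_iff' h₁ _).1 h₂

lemma TubeInjective.of_admissible (h : (R, r, α) ∈ admissible K x 0) :
    TubeInjective K x R r α h.1.1 := by
  obtain ⟨-, -, -, hα, hr, h⟩ := h
  intro l
  rw [HMap_comp (Metric.self_subset_cthickening (δ := 0) K) (subset_refl (Metric.ball x R))
    (Metric.cthickening_mono hα K) (Metric.ball_subset_ball (x := x) hr)]
  intro a b hab
  exact (h l).1 (Subtype.ext hab)

/-- The map from `F(0,R')` factors through the isomorphism `F(0,R') → F(0,R)`. -/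
lemma TubeInjective.mono_radius (h : TubeInjective K x R r α hr) (hRR' : R ≤ R')
    (hR : 0 < R) (hg : IsGoodRadius K x R') : TubeInjective K x R' r α (hr.trans hRR') := by
  intro l
  rw [HMap_comp (subset_refl K) (Metric.ball_subset_ball hRR')
    (Metric.self_subset_cthickening (δ := α) K) (Metric.ball_subset_ball (x := x) hr),
    LinearMap.coe_comp]
  exact (h l).comp (hg.2 l R hR hRR').1.1

/-- A point moved by less than `r` reaches `x` only from inside `B_r(x)`, so `π` induces `F(α,r) →
F(0,0)`. Precomposed with `F(0,R) → F(α,r)`, it gives the isomorphism `F(0,R) → F(0,0)`. -/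
lemma tubeInjective_of_retraction {π : 𝕏 → 𝕏} (hid : ∀ x ∈ K, π x = x)
    (hπ : ContinuousOn π (Metric.cthickening α K)) (hm : Set.MapsTo π (Metric.cthickening α K) K)
    (hd : ∀ y ∈ Metric.cthickening α K, dist y (π y) < r) (hg : IsGoodRadius K x R)
    (hR : 0 < R) (hr : r ≤ R) : TubeInjective K x R r α hr := by
  intro l
  have hf : IsComplPairMap π (Metric.cthickening α K) (Metric.ball x r) K {x} := by
    refine ⟨hπ, hm, fun y hy hyr hyx => hyr ?_⟩
    have := hd y hy
    rwa [Set.mem_singleton_iff.1 hyx] at this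
  exact HMap_injective_of_retract hf hid _ _ (subset_refl K)
    (Set.singleton_subset_iff.2 (Metric.mem_ball_self hR)) l (hg.2 l R hR le_rfl).2.1

/-- If `D_ε(K)` retracts to `K` along paths of length at most `η` in `D_α(K)`, and `R ≥ r + η`,
then every class of `H(D_ε(K), D_ε(K) - B_R(x))` agrees in `H(D_α(K), D_α(K) - B_r(x))` with a
class of `H(K, K - B_R(x))`. -/
lemma range_HMap_le_of_homotopy {π : 𝕏 → 𝕏} {γ : 𝕏 → 𝕏 → ℝ → 𝕏} {δ : ℝ}
    (hγ : ∀ y ∈ Metric.thickening δ K, ∀ z, dist y z < δ → IsShortestPath y z (γ y z))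
    (hγc : ContinuousOn (fun p : 𝕏 × 𝕏 × ℝ => γ p.1 p.2.1 p.2.2)
      {p | p.1 ∈ Metric.thickening δ K ∧ dist p.1 p.2.1 < δ ∧ p.2.2 ∈ Set.Icc (0 : ℝ) 1})
    (hε₀ : 0 ≤ ε) (hεδ : ε < δ) (hηδ : η < δ)
    (hπ : ContinuousOn π (Metric.cthickening ε K)) (hm : Set.MapsTo π (Metric.cthickening ε K) K)
    (hd : ∀ y ∈ Metric.cthickening ε K, dist y (π y) ≤ η) (hηα : η ≤ α) (hεα : ε ≤ α)
    (hg : IsGoodRadius K x R) (hr₀ : 0 < r) (hr : r ≤ R) (hrR : r + η ≤ R) (l : ℕ) :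
    LinearMap.range (HMap l (Metric.cthickening_mono hεα K) (Metric.ball_subset_ball (x := x) hr)) ≤
      LinearMap.range (HMap l (Metric.self_subset_cthickening (δ := α) K)
        (Metric.ball_subset_ball (x := x) hr)) := by
  have hε : Metric.cthickening ε K ⊆ Metric.thickening δ K :=
    Metric.cthickening_subset_thickening' (hε₀.trans_lt hεδ) hεδ K
  have hsp : ∀ y ∈ Metric.cthickening ε K, IsShortestPath y (π y) (γ y (π y)) := fun y hy =>
    hγ y (hε hy) _ ((hd y hy).trans_lt hηδ)
  have hstart : ∀ y ∈ Metric.cthickening ε K, ∀ t ∈ Set.Icc (0 : ℝ) 1,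
      dist (γ y (π y) t) y ≤ η := by
    intro y hy t ht
    have h := (hsp y hy).2.2 t ht 0 (by simp)
    rw [(hsp y hy).1, sub_zero, abs_of_nonneg ht.1] at h
    rw [h]
    exact (mul_le_of_le_one_left dist_nonneg ht.2).trans (hd y hy)
  -- Closeness to `π y ∈ K` keeps the path in `D_α(K)`; closeness to `y`, shown before, keeps it
  -- away from `B_r(x)`.
  have hend : ∀ y ∈ Metric.cthickening ε K, ∀ t ∈ Set.Icc (0 : ℝ) 1,
      dist (γ y (π y) t) (π y) ≤ η := by
    intro y hy t ht
    have h := (hsp y hy).2.2 t ht 1 (by simp)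
    rw [(hsp y hy).2.1, abs_of_nonpos (by linarith [ht.2])] at h
    rw [h]
    exact (mul_le_of_le_one_left dist_nonneg (by linarith [ht.1])).trans (hd y hy)
  have hdisp : ∀ y ∉ Metric.ball x R, ∀ z, dist z y ≤ η → z ∉ Metric.ball x r := by
    intro y hy z hz hzr
    rw [Metric.mem_ball] at hy hzr
    have := dist_triangle_left y x z
    linarith
  have hj := isComplPairMap_id (Metric.cthickening_mono hεα K) (Metric.ball_subset_ball (x := x) hr)
  have hp : IsComplPairMap π (Metric.cthickening ε K) (Metric.ball x R) K (Metric.ball x r) :=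
    ⟨hπ, hm, fun y hy hyR => hdisp y hyR _ (by rw [dist_comm]; exact hd y hy)⟩
  have hi := isComplPairMap_id (Metric.self_subset_cthickening (δ := α) K)
    (subset_refl (Metric.ball x r))
  have key : hj.hMap l = hi.hMap l ∘ₗ hp.hMap l := by
    rw [← IsComplPairMap.comp_hMap]
    refine hj.hMap_eq_of_homotopy (hi.comp hp) (fun y t => γ y (π y) t) ?_ ?_ ?_ ?_ ?_ l
    · refine hγc.comp (f := fun p : 𝕏 × ℝ => (p.1, π p.1, p.2)) ?_ ?_
      · exact continuousOn_fst.prodMk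
          ((hπ.comp continuousOn_fst fun p hp => hp.1).prodMk continuousOn_snd)
      · exact fun p hp => ⟨hε hp.1, (hd _ hp.1).trans_lt hηδ, hp.2⟩
    · exact fun y hy t ht =>
        Metric.mem_cthickening_of_dist_le _ _ _ _ (hm hy) ((hend y hy t ht).trans hηα)
    · exact fun y hy hyR t ht => hdisp y hyR _ (hstart y hy t ht)
    · exact fun y hy => (hsp y hy).1
    · exact fun y hy => (hsp y hy).2.1
  rw [isComplPairMap_id_hMap (Metric.cthickening_mono hεα K) (Metric.ball_subset_ball hr),
    isComplPairMap_id_hMap (Metric.self_subset_cthickening K) (subset_refl _)] at key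
  rw [key]
  rintro _ ⟨z, rfl⟩
  -- `π` only yields a class in `F(0,r)`; it lifts to `F(0,R)` because `R` is a good radius.
  obtain ⟨w, hw⟩ := (hg.2 l r hr₀ hr).1.2 (hp.hMap l z)
  refine ⟨w, ?_⟩
  rw [LinearMap.comp_apply, ← hw, HMap_comp (subset_refl K) (Metric.ball_subset_ball hr)
    (Metric.self_subset_cthickening (δ := α) K) (subset_refl (Metric.ball x r))]
  rfl

lemma mem_admissible (hg : IsGoodRadius K x R) (hr : r ≤ R) (hαr : α < r) (hεα : ε ≤ α)
    (hinj : TubeInjective K x R r α hr)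
    (hrange : ∀ l : ℕ, LinearMap.range (HMap l (Metric.cthickening_mono hεα K)
        (Metric.ball_subset_ball (x := x) hr)) ≤
      LinearMap.range (HMap l (Metric.self_subset_cthickening (δ := α) K)
        (Metric.ball_subset_ball (x := x) hr))) :
    (R, r, α) ∈ admissible K x ε := by
  refine ⟨⟨hr, hαr, hεα⟩, hg.1, hg.2, hεα, hr, fun l => ?_⟩
  have hcomp := HMap_comp (Metric.self_subset_cthickening (δ := ε) K)
    (subset_refl (Metric.ball x R)) (Metric.cthickening_mono hεα K)
    (Metric.ball_subset_ball (x := x) hr) l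
  constructor
  · intro a b hab
    refine hinj l ?_
    rw [hcomp]
    exact congrArg Subtype.val hab
  · rintro ⟨b, hb⟩
    obtain ⟨a, ha⟩ := hrange l hb
    rw [hcomp] at ha
    exact ⟨a, Subtype.ext ha⟩

/-- On the compact part `L` of a stratum, the local homology groups are uniformly computed by
small balls. -/
lemma exists_uniform_radius {S : Set (Set 𝕏)} (hS : IsHomologyStratification K S) {X L : Set 𝕏}
    (hX : X ∈ S) (hLX : L ⊆ X) (hL : IsCompact L) :
    ∃ R₀ > 0, ∀ x ∈ L, ∀ l : ℕ, ∀ ρ : ℝ, ∀ hρ : 0 < ρ, ρ ≤ R₀ →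
      Function.Bijective (HMap l (subset_refl K)
        (Set.singleton_subset_iff.2 (Metric.mem_ball_self hρ) : {x} ⊆ Metric.ball x ρ)) := by
  refine hL.induction_on (p := fun s => ∃ R₀ > 0, ∀ x ∈ s, ∀ l : ℕ, ∀ ρ : ℝ, ∀ hρ : 0 < ρ,
      ρ ≤ R₀ → Function.Bijective (HMap l (subset_refl K)
        (Set.singleton_subset_iff.2 (Metric.mem_ball_self hρ) : {x} ⊆ Metric.ball x ρ)))
    ⟨1, one_pos, by simp⟩ ?_ ?_ ?_
  · rintro s t hst ⟨R₀, hR₀, h⟩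
    exact ⟨R₀, hR₀, fun x hx => h x (hst hx)⟩
  · rintro s t ⟨R₁, hR₁, h₁⟩ ⟨R₂, hR₂, h₂⟩
    refine ⟨min R₁ R₂, lt_min hR₁ hR₂, ?_⟩
    rintro x (hx | hx) l ρ hρ hle
    · exact h₁ x hx l ρ hρ (hle.trans (min_le_left _ _))
    · exact h₂ x hx l ρ hρ (hle.trans (min_le_right _ _))
  · intro x hx
    obtain ⟨r₀, hr₀, h⟩ := hS.local_iso X hX x (hLX hx)
    refine ⟨Metric.ball x (r₀ / 4) ∩ L, inter_mem
      (mem_nhdsWithin_of_mem_nhds (Metric.ball_mem_nhds x (by positivity))) self_mem_nhdsWithin,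
      r₀ / 8, by positivity, ?_⟩
    rintro y ⟨hy, hyL⟩ l ρ hρ hle
    have hd : dist x y < r₀ / 4 := by rw [dist_comm]; exact hy
    -- Since `d(x,y) < r₀/4`, any `ρ ≤ r₀/8` is below `r₀/2 - d(x,y)`, as tameness at `x` requires.
    exact ((h (r₀ / 2) (by positivity) (by linarith) l).2 y
      ⟨Metric.ball_subset_ball (by linarith) hy, hLX hyL⟩ ρ hρ (by linarith)).2

end

/-! ### Weak seemliness of the admissible triples -/

section

variable {𝕏 : Type u} [MetricSpace 𝕏]

lemma isWeaklySeemly_univ : IsWeaklySeemly fun _ => Set.univ := by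
  refine ⟨1, one_pos, fun _ => 0, fun _ => 1, fun _ _ => ⟨le_rfl, one_pos⟩,
    fun _ _ _ _ _ => le_rfl, fun _ _ _ _ _ => le_rfl, rfl, tendsto_const_nhds,
    tendsto_const_nhds, fun _ _ _ _ => ⟨(0, 0), trivial⟩, ?_⟩
  simp [Metric.hausdorffEDist_self]

/-- A criterion for weak seemliness with constant upper bound `a₀`: up to an error `m ε`, triples
that are admissible for `0` can be moved to triples admissible for `ε`. -/
lemma isWeaklySeemly_of_dist_le {A : ℝ → Set (ℝ × ℝ × ℝ)} {m : ℝ → ℝ} {ε₀ a₀ : ℝ} (hε₀ : 0 < ε₀)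
    (hm₀ : m 0 = 0) (hmono : MonotoneOn m (Set.Icc 0 ε₀)) (hlt : m ε₀ < a₀)
    (hlim : Tendsto m (𝓝[>] 0) (𝓝 0))
    (hne : ∀ ε ∈ Set.Icc 0 ε₀, ∀ a ∈ Set.Icc (m ε) a₀, (alphaSection (A ε) a).Nonempty)
    (hsub : ∀ ε ∈ Set.Icc 0 ε₀, A ε ⊆ A 0)
    (hdist : ∀ ε ∈ Set.Icc 0 ε₀, ∀ a ∈ Set.Icc (m ε) a₀, ∀ p ∈ alphaSection (A 0) a,
      ∃ q ∈ alphaSection (A ε) a, dist p q ≤ m ε) : IsWeaklySeemly A := by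
  refine ⟨ε₀, hε₀, m, fun _ => a₀, fun ε hε => ⟨?_, ?_⟩, hmono, fun _ _ _ _ _ => le_rfl, hm₀,
    hlim, tendsto_const_nhds, hne, ?_⟩
  · rw [← hm₀]
    exact hmono ⟨le_rfl, hε₀.le⟩ hε hε.1
  · exact (hmono hε ⟨hε₀.le, le_rfl⟩ hε.2).trans_lt hlt
  · have hlim' : Tendsto (fun ε => ENNReal.ofReal (m ε)) (𝓝[>] 0) (𝓝 0) := by
      simpa using ENNReal.tendsto_ofReal hlim
    refine tendsto_of_tendsto_of_tendsto_of_le_of_le' tendsto_const_nhds hlim'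
      (Eventually.of_forall fun _ => zero_le) ?_
    filter_upwards [Ioc_mem_nhdsGT hε₀] with ε hε
    have hε' : ε ∈ Set.Icc 0 ε₀ := ⟨hε.1.le, hε.2⟩
    refine iSup₂_le fun a ha => Metric.hausdorffEDist_le_of_mem_edist ?_ ?_
    · intro p hp
      obtain ⟨q, hq, hpq⟩ := hdist ε hε' a ha p hp
      exact ⟨q, hq, by rw [edist_dist]; exact ENNReal.ofReal_le_ofReal hpq⟩
    · intro q hq
      exact ⟨q, hsub ε hε' hq, by simp⟩

/-- Injectivity does not involve `ε`, and the image condition is automatic at `0` because `D_0(K) =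
K`. -/
lemma admissible_subset_zero {K : Set 𝕏} {x : 𝕏} {ε : ℝ} (hK : IsClosed K) (hε : 0 ≤ ε) :
    admissible K x ε ⊆ admissible K x 0 := by
  rintro ⟨R, r, α⟩ ⟨⟨hr, hαr, hεα⟩, hb, hg, hα, hr', h⟩
  have hK0 : Metric.cthickening 0 K ⊆ K := by
    rw [Metric.cthickening_zero, hK.closure_eq]
  refine mem_admissible ⟨hb, hg⟩ hr hαr (hε.trans hεα) ?_ ?_
  · intro l
    rw [HMap_comp (Metric.self_subset_cthickening (δ := ε) K) (subset_refl (Metric.ball x R))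
      (Metric.cthickening_mono hα K) (Metric.ball_subset_ball (x := x) hr)]
    intro a b hab
    exact (h l).1 (Subtype.ext hab)
  · intro l
    rw [HMap_comp hK0 (subset_refl (Metric.ball x R))
      (Metric.self_subset_cthickening (δ := α) K) (Metric.ball_subset_ball (x := x) hr)]
    exact LinearMap.range_comp_le_range _ _

theorem isWeaklySeemly_admissibleOn (hconv : LocallyStronglyConvex 𝕏) {K L : Set 𝕏}
    (hK : IsCompact K) (hret : IsNeighborhoodRetract K) {R₀ : ℝ} (hR₀ : 0 < R₀)
    (hgood : ∀ x ∈ L, ∀ R ≤ R₀, IsGoodRadius K x R) : IsWeaklySeemly (admissibleOn K L) := by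
  rcases L.eq_empty_or_nonempty with rfl | ⟨x₀, hx₀⟩
  -- An intersection over no points contains all triples, even those violating `R ≥ r > α`, so this
  -- case is separate.
  · rw [show admissibleOn K ∅ = fun _ => Set.univ from funext fun ε => by simp [admissibleOn]]
    exact isWeaklySeemly_univ
  obtain ⟨δ, hδ, γ, hγ, hγc⟩ := exists_continuous_shortestPaths hconv hK
  obtain ⟨π, hid, hπ⟩ := exists_retraction hK hret
  obtain ⟨ε₁, hε₁, hπc, hπm, hπd⟩ := hπ (R₀ / 8) (by positivity)
  -- The upper bound for `α`: within `ε₁` for the retraction, below `δ` for the geodesics, and small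
  -- against `R₀` to leave room for shifting radii.
  obtain ⟨a₀, ha₀, ha₀ε₁, ha₀δ, ha₀R⟩ : ∃ a₀ > 0, a₀ ≤ ε₁ ∧ a₀ < δ ∧ a₀ ≤ R₀ / 8 :=
    ⟨min ε₁ (min (δ / 2) (R₀ / 8)), by positivity, min_le_left _ _,
      ((min_le_right _ _).trans (min_le_left _ _)).trans_lt (by linarith),
      (min_le_right _ _).trans (min_le_right _ _)⟩
  -- `α ≥ m ε` ensures both `α ≥ ε` and that the geodesics to `π y` stay in `D_α(K)`.
  set m : ℝ → ℝ := fun ε => max ε (displacement K π ε) with hm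
  have hm_mono : ∀ ε ε', ε ≤ ε' → ε' ≤ ε₁ → m ε ≤ m ε' := fun ε ε' h h' =>
    max_le_max h (displacement_mono hπd h h')
  have hm_small : ∀ c > 0, ∃ ε > 0, ε ≤ ε₁ ∧ m ε ≤ c := by
    intro c hc
    obtain ⟨ε, hε, -, -, hd⟩ := hπ c hc
    refine ⟨min (min ε ε₁) c, by positivity, (min_le_left _ _).trans (min_le_right _ _),
      max_le (min_le_right _ _) (displacement_le hc.le fun y hy => hd y ?_)⟩
    exact Metric.cthickening_mono ((min_le_left _ _).trans (min_le_left _ _)) K hy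
  have hm_nonneg : ∀ ε, 0 ≤ m ε := fun ε => displacement_nonneg.trans (le_max_right _ _)
  have hm_zero : m 0 = 0 := by simp [hm, displacement_zero hK.isClosed hid]
  have hm_lim : Tendsto m (𝓝[>] 0) (𝓝 0) := by
    rw [Metric.tendsto_nhds]
    intro c hc
    obtain ⟨ε, hε, hεε₁, hmε⟩ := hm_small (c / 2) (by positivity)
    filter_upwards [Ioc_mem_nhdsGT hε] with t ht
    rw [Real.dist_0_eq_abs, abs_of_nonneg (hm_nonneg t)]
    linarith [hm_mono t ε ht.2 hεε₁]
  obtain ⟨ε₀, hε₀, hε₀ε₁, hmε₀⟩ := hm_small (a₀ / 2) (by positivity)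
  have hinj : ∀ x ∈ L, ∀ R r α : ℝ, ∀ hr : r ≤ R, IsGoodRadius K x R → α ≤ a₀ → R₀ / 8 < r →
      TubeInjective K x R r α hr := by
    intro x hx R r α hr hR hα hr'
    have hsub : Metric.cthickening α K ⊆ Metric.cthickening ε₁ K :=
      Metric.cthickening_mono (hα.trans ha₀ε₁) K
    exact tubeInjective_of_retraction hid (hπc.mono hsub) (hπm.mono_left hsub)
      (fun y hy => (hπd y (hsub hy)).trans_lt hr') hR (by linarith) hr
  have hmem : ∀ x ∈ L, ∀ ε ∈ Set.Icc 0 ε₀, ∀ a ∈ Set.Icc (m ε) a₀, ∀ R r : ℝ,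
      ∀ hr : r ≤ R, IsGoodRadius K x R → a < r → r + m ε ≤ R → TubeInjective K x R r a hr →
        (R, r, a) ∈ admissible K x ε := by
    intro x hx ε hε a ha R r hr hR har hrR hI
    have hεa : ε ≤ a := (le_max_left _ _).trans ha.1
    have hεε₁ : ε ≤ ε₁ := hε.2.trans hε₀ε₁
    have hsub : Metric.cthickening ε K ⊆ Metric.cthickening ε₁ K :=
      Metric.cthickening_mono hεε₁ K
    exact mem_admissible hR hr har hεa hI (range_HMap_le_of_homotopy hγ hγc hε.1
      ((hεa.trans ha.2).trans_lt ha₀δ) ((ha.1.trans ha.2).trans_lt ha₀δ) (hπc.mono hsub)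
      (hπm.mono_left hsub)
      (fun y hy => (dist_le_displacement hπd hεε₁ hy).trans (le_max_right _ _)) ha.1 hεa hR
      (by linarith [hε.1]) hr hrR)
  refine isWeaklySeemly_of_dist_le (a₀ := a₀) hε₀ hm_zero
    (fun ε _ ε' hε' h => hm_mono ε ε' h (hε'.2.trans hε₀ε₁)) (by linarith) hm_lim ?_ ?_ ?_
  · intro ε hε a ha
    refine ⟨(R₀, R₀ / 2), Set.mem_iInter₂.2 fun x hx => ?_⟩
    have := ha.1.trans ha.2
    exact hmem x hx ε hε a ha R₀ (R₀ / 2) (by linarith) (hgood x hx R₀ le_rfl) (by linarith [ha.2])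
      (by linarith) (hinj x hx _ _ _ _ (hgood x hx R₀ le_rfl) ha.2 (by linarith))
  · exact fun ε hε => Set.iInter₂_mono fun x _ => admissible_subset_zero hK.isClosed hε.1
  · rintro ε hε a ha ⟨R, r⟩ hp
    replace hp : ∀ x ∈ L, (R, r, a) ∈ admissible K x 0 := Set.mem_iInter₂.1 hp
    obtain ⟨hr, har, ha0⟩ : r ≤ R ∧ a < r ∧ 0 ≤ a := (hp x₀ hx₀).1
    have hη := hm_nonneg ε
    have hηa := ha.1.trans ha.2
    have hgoodR : ∀ x ∈ L, IsGoodRadius K x R := fun x hx => ⟨(hp x hx).2.1, (hp x hx).2.2.1⟩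
    have hI : ∀ x ∈ L, TubeInjective K x R r a hr := fun x hx => .of_admissible (hp x hx)
    rcases le_or_gt (r + m ε) R with h | h
    · exact ⟨(R, r), Set.mem_iInter₂.2 fun x hx =>
        hmem x hx ε hε a ha R r hr (hgoodR x hx) har h (hI x hx), by simpa using hη⟩
    -- Now `R - r < m ε ≤ R₀/8`. If `R ≤ R₀/2`, then `r + m ε` is still at most `R₀`, hence a good
    -- radius.
    rcases le_or_gt R (R₀ / 2) with h' | h'
    · refine ⟨(r + m ε, r), Set.mem_iInter₂.2 fun x hx => ?_, ?_⟩
      · have hg := hgood x hx (r + m ε) (by linarith)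
        exact hmem x hx ε hε a ha _ r (by linarith) hg har le_rfl
          ((hI x hx).mono_radius h.le (by linarith) hg)
      · rw [Prod.dist_eq, dist_self, max_eq_left dist_nonneg, Real.dist_eq, abs_le]
        constructor <;> linarith
    -- Here `R` may exceed `R₀`, and larger radii need not be good. Instead `r` drops to `R - m ε >
    -- R₀/8`, where the retraction gives injectivity anew.
    · refine ⟨(R, R - m ε), Set.mem_iInter₂.2 fun x hx => ?_, ?_⟩
      · exact hmem x hx ε hε a ha R _ (by linarith) (hgoodR x hx) (by linarith [ha.2])
          (by linarith) (hinj x hx _ _ _ _ (hgoodR x hx) ha.2 (by linarith))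
      · rw [Prod.dist_eq, dist_self, max_eq_right dist_nonneg, Real.dist_eq, abs_le]
        constructor <;> linarith

end

end

end Seemly

theorem mainTheorem3 {𝕏 : Type*} [MetricSpace 𝕏] [CompleteSpace 𝕏] [LocallyCompactSpace 𝕏]
    (hmid : Seemly.HasMidpoints 𝕏) (hconv : Seemly.LocallyStronglyConvex 𝕏)
    (K : Set 𝕏) (hK : IsCompact K) (hret : Seemly.IsNeighborhoodRetract K)
    (hball : ∃ δ > 0, ∀ x ∈ K, ∀ ρ : ℝ, 0 < ρ → ρ ≤ δ →
      Seemly.IsTopologicalBall (Metric.closedBall x ρ))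
    (S : Set (Set 𝕏)) (hS : Seemly.IsHomologyStratification K S) :
    Seemly.IsWeaklyLocallyHomologicallySeemly K S := by
  intro X hX
  have hXK : X ⊆ K := hS.sUnion_eq ▸ Set.subset_sUnion_of_mem hX
  -- Every `w > 0` works: positivity alone makes `shrink X w` compact, which gives a uniform radius.
  filter_upwards [self_mem_nhdsWithin] with w hw
  obtain ⟨δ, hδ, hball⟩ := hball
  obtain ⟨R₁, hR₁, hpt⟩ := Seemly.exists_uniform_radius hS hX Set.sdiff_subset
    (Seemly.isCompact_shrink hK hXK hw)
  refine Seemly.isWeaklySeemly_admissibleOn hconv hK hret (lt_min hδ hR₁) fun x hx R hR =>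
    Seemly.isGoodRadius_of_le (fun ρ hρ h => ?_) (fun l ρ hρ h => ?_) hR
  · exact hball x (hXK hx.1) ρ hρ (h.trans (min_le_left _ _))
  · exact hpt x hx l ρ hρ (h.trans (min_le_right _ _))
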